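/- Let $\Lambda>0$ and $m>0$ with $3m\sqrt{\Lambda}<1$, let $r_c$ be the largest positive root of $\frac{\Lambda r^2}{3}+\frac{2m}{r}-1$, and consider the expanding region $\mathcal{R}^+=\{(t,r,\omega): t\in\mathbb{R},\ r>r_c,\ \omega\in\mathbb{S}^2\}$ of Schwarzschild de Sitter with the metric $$g=-\phi^2\,dr^2+\bar g_r,\qquad \bar g_r=\Bigl(\frac{\Lambda r^2}{3}+\frac{2m}{r}-1\Bigr)dt^2+r^2\gamma,\qquad \phi=\Bigl(\frac{\Lambda r^2}{3}+\frac{2m}{r}-1\Bigr)^{-1/2},$$ where $\gamma$ is the standard metric on the unit sphere $\mathbb{S}^2$. Let $\Sigma_r$ denote the level sets of $r$ in $\mathcal{R}^+$, with induced metric $\bar g_r$ and volume measure $d\mu_{\bar g_r}$, and let $|\nabla\!\!\!\!/\,\psi|$ be the norm of the gradient of $\psi$ along the spheres of constant $(t,r)$, with respect to the metric $r^2\gamma$. Let $\psi$ be a real-valued $C^2$ solution of the wave equation $\Box_g\psi=0$ on $\mathcal{R}^+$. Then for all $r_2>r_1>r_c$, $$\int_{\Sigma_{r_2}}\Bigl\{\frac{1}{\phi^2}(\partial_r\psi)^2+\phi^2(\partial_t\psi)^2+|\nabla\!\!\!\!/\,\psi|^2\Bigr\}\phi\,d\mu_{\bar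 g_{r_2}}\ \le\ \int_{\Sigma_{r_1}}\Bigl\{\frac{1}{\phi^2}(\partial_r\psi)^2+\phi^2(\partial_t\psi)^2+|\nabla\!\!\!\!/\,\psi|^2\Bigr\}\phi\,d\mu_{\bar g_{r_1}},$$ as an inequality in $[0,\infty]$; in particular the left side is finite whenever the right side is. -/

import Mathlib

/-!
In the chart `(t, x)` one has `det g = -1`, so `□_g ψ` is the coordinate divergence of the gradient
`∇ψ`. The current `J = (∂_r ψ) ∇ψ - ½ g(∇ψ, ∇ψ) ∂_r` of the multiplier `∂_r` has flux
`-½ {φ⁻² (∂_r ψ)² + φ² (∂_t ψ)² + |∇̸ψ|²}` through the level sets of `r`. For solutions, `div J`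
is a combination of the squares of the derivatives of `ψ` with nonnegative coefficients, because
the derivative of `warp` is at least `2 warp / r` for `r ≥ 3 m`.

To integrate over the noncompact slices, multiply `J` by `ζ(r) χ`, with `χ` a cutoff in `t` whose
support shrinks with increasing `r` faster than light: the boundary of the shrinking region is
spacelike, so the extra term has a sign. Varying `ζ` shows that the energy localized by `χ` is
nonincreasing in `r` in the sense of distributions, hence pointwise by continuity, and monotone
convergence removes the cutoff.
-/

open MeasureTheory
open scoped ENNReal

namespace SdS

noncomputable section

/-- Euclidean three-space. -/
abbrev E3 : Type := EuclideanSpace ℝ (Fin 3)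

/-- The expanding region is described in a single global chart: the point with coordinates
`(t, r, ω)`, `ω` in the unit sphere, is represented by `(t, x)` with `x = r ω`. -/
abbrev Spacetime : Type := ℝ × E3

/-- The area radius `r = |x|`. -/
def radius (p : Spacetime) : ℝ := ‖p.2‖

/-- The function `Λ r² / 3 + 2 m / r - 1`. -/
def warp (Λ m r : ℝ) : ℝ := Λ * r ^ 2 / 3 + 2 * m / r - 1

/-- The area radius of the cosmological horizon: the largest positive root of
`Λ r² / 3 + 2 m / r - 1`. -/
def cosmologicalRadius (Λ m : ℝ) : ℝ := sSup {r : ℝ | 0 < r ∧ warp Λ m r = 0}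

/-- The expanding region `r > r_c`. -/
def expandingRegion (Λ m : ℝ) : Set Spacetime := {p | cosmologicalRadius Λ m < radius p}

/-- The lapse function of the foliation by the level sets of `r`. -/
def lapse (Λ m r : ℝ) : ℝ := 1 / √(warp Λ m r)

/-- The coordinate vector field `∂_t`. -/
def vecT : Spacetime := (1, 0)

/-- The coordinate vector field `∂_r` (at constant `t` and `ω`). -/
def vecR (p : Spacetime) : Spacetime := (0, (radius p)⁻¹ • p.2)

/-- The differential `dt`. -/
def dT (v : Spacetime) : ℝ := v.1

/-- The differential `dr` at `p`. -/
def dR (p v : Spacetime) : ℝ := inner ℝ p.2 v.2 / radius p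

/-- The symmetric form `r² γ` at `p`, where `γ` is the standard metric of the unit sphere; in the
present chart the Euclidean metric of three-space is `dr² + r² γ`. -/
def sphereForm (p v w : Spacetime) : ℝ := inner ℝ v.2 w.2 - dR p v * dR p w

/-- The Schwarzschild de Sitter metric
`g = - φ² dr² + (Λ r² / 3 + 2 m / r - 1) dt² + r² γ`. -/
def metric (Λ m : ℝ) (p v w : Spacetime) : ℝ :=
  -(lapse Λ m (radius p)) ^ 2 * (dR p v * dR p w)
    + warp Λ m (radius p) * (dT v * dT w) + sphereForm p v w

/-- The coordinate basis `∂_0 = ∂_t, ∂_1, ∂_2, ∂_3` of the chart `(t, x)`. -/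
def frame : Fin 4 → Spacetime :=
  Fin.cons (1, 0) (fun i : Fin 3 => (0, EuclideanSpace.single i 1))

/-- The components `g_{μν}`. -/
def metricMatrix (Λ m : ℝ) (p : Spacetime) : Matrix (Fin 4) (Fin 4) ℝ :=
  Matrix.of fun μ ν => metric Λ m p (frame μ) (frame ν)

/-- The coordinate derivative `∂_μ u`. -/
def partialDeriv (μ : Fin 4) (u : Spacetime → ℝ) (p : Spacetime) : ℝ := fderiv ℝ u p (frame μ)

/-- The wave operator
`□_g ψ = |det g|^{-1/2} ∂_μ (|det g|^{1/2} g^{μν} ∂_ν ψ)`. -/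
def waveOperator (Λ m : ℝ) (ψ : Spacetime → ℝ) (p : Spacetime) : ℝ :=
  (√|(metricMatrix Λ m p).det|)⁻¹ *
    ∑ μ : Fin 4, partialDeriv μ
      (fun q => √|(metricMatrix Λ m q).det| *
        ∑ ν : Fin 4, (metricMatrix Λ m q)⁻¹ μ ν * partialDeriv ν ψ q) p

/-- Classical solutions of `□_g ψ = 0` on the expanding region. -/
structure IsWaveSolution (Λ m : ℝ) (ψ : Spacetime → ℝ) : Prop where
  contDiffOn : ContDiffOn ℝ 2 ψ (expandingRegion Λ m)
  wave_eq : ∀ p ∈ expandingRegion Λ m, waveOperator Λ m ψ p = 0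

/-- The angular gradient: the projection of the gradient of `ψ` to the tangent space `x^⊥` of the
sphere of area radius `r = |x|` through `p = (t, x)`. On vectors tangent to that sphere, `g` is the
Euclidean inner product, so the norm of this vector is its norm in the induced metric. -/
def angularGradient (ψ : Spacetime → ℝ) (p : Spacetime) : E3 :=
  (ℝ ∙ p.2)ᗮ.starProjection (gradient (fun x : E3 => ψ (p.1, x)) p.2)

/-- The density `φ⁻² (∂_r ψ)² + φ² (∂_t ψ)² + |∇̸ψ|²`. -/
def energyDensity (Λ m : ℝ) (ψ : Spacetime → ℝ) (p : Spacetime) : ℝ :=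
  1 / (lapse Λ m (radius p)) ^ 2 * (fderiv ℝ ψ p (vecR p)) ^ 2
    + (lapse Λ m (radius p)) ^ 2 * (fderiv ℝ ψ p vecT) ^ 2
    + ‖angularGradient ψ p‖ ^ 2

/-- The volume measure of the metric `(Λ r² / 3 + 2 m / r - 1) dt² + r² γ` induced on the level
set `Σ_r`, as a measure on the spacetime carried by `Σ_r`: the image under `(t, ω) ↦ (t, r ω)` of
`(Λ r² / 3 + 2 m / r - 1)^{1/2} r² dt dσ(ω)`, with `σ` the surface measure of the unit sphere. -/
def sliceVolume (Λ m r : ℝ) : Measure Spacetime :=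
  Measure.map (fun q : ℝ × Metric.sphere (0 : E3) 1 => (q.1, r • (q.2 : E3)))
    (ENNReal.ofReal (√(warp Λ m r) * r ^ 2) •
      (volume : Measure ℝ).prod (volume : Measure E3).toSphere)

/-- The energy `∫_{Σ_r} { φ⁻² (∂_r ψ)² + φ² (∂_t ψ)² + |∇̸ψ|² } φ dμ`, with values in `[0, ∞]`. -/
def energy (Λ m : ℝ) (ψ : Spacetime → ℝ) (r : ℝ) : ℝ≥0∞ :=
  ∫⁻ p, ENNReal.ofReal (energyDensity Λ m ψ p * lapse Λ m (radius p)) ∂(sliceVolume Λ m r)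

/-- In the subextremal range the largest positive root exists. -/
theorem isGreatest_cosmologicalRadius {Λ m : ℝ} (hΛ : 0 < Λ) (hm : 0 < m)
    (hsub : 3 * m * √Λ < 1) :
    IsGreatest {r : ℝ | 0 < r ∧ warp Λ m r = 0} (cosmologicalRadius Λ m) := by
  have hs : 0 < √Λ := Real.sqrt_pos.2 hΛ
  have hss : √Λ * √Λ = Λ := Real.mul_self_sqrt hΛ.le
  have hset : {r : ℝ | 0 < r ∧ warp Λ m r = 0}
      = {r : ℝ | 2 * m ≤ r ∧ Λ * r ^ 3 - 3 * r + 6 * m = 0} := by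
    ext r
    simp only [Set.mem_ofPred_eq, warp]
    constructor
    · rintro ⟨h0, h⟩
      have h1 : Λ * r ^ 3 - 3 * r + 6 * m = 0 := by
        field_simp at h
        linarith
      refine ⟨?_, h1⟩
      have : 0 < Λ * r ^ 3 := by positivity
      linarith
    · rintro ⟨h0, h⟩
      have hr : 0 < r := by linarith
      refine ⟨hr, ?_⟩
      field_simp
      linarith
  rw [cosmologicalRadius, hset]
  set S : Set ℝ := {r : ℝ | 2 * m ≤ r ∧ Λ * r ^ 3 - 3 * r + 6 * m = 0} with hS
  have hclosed : IsClosed S :=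
    (isClosed_le continuous_const continuous_id).inter
      (isClosed_eq (by fun_prop) continuous_const)
  have hbdd : BddAbove S := by
    refine ⟨3 / Λ + 1, ?_⟩
    rintro r ⟨h0, h⟩
    have hr : 0 < r := by linarith
    have h2 : Λ * r ^ 2 < 3 := by
      by_contra! hc
      nlinarith
    by_contra! hc
    have h4 : 3 < Λ * r := by
      have : 3 / Λ < r := by linarith
      rwa [div_lt_iff₀ hΛ, mul_comm] at this
    have h5 : 1 < r := by
      have : 0 < 3 / Λ := by positivity
      linarith
    nlinarith
  have hne : S.Nonempty := by
    have hcont : ContinuousOn (fun r : ℝ => Λ * r ^ 3 - 3 * r + 6 * m)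
        (Set.Icc (1 / √Λ) (2 / √Λ)) := by fun_prop
    have hle : 1 / √Λ ≤ 2 / √Λ := by gcongr; norm_num
    have ha : Λ * (1 / √Λ) ^ 3 - 3 * (1 / √Λ) + 6 * m ≤ 0 := by
      have : Λ * (1 / √Λ) ^ 3 = 1 / √Λ := by
        field_simp
        nlinarith
      rw [this]
      have h3 : 3 * m < 1 / √Λ := by rwa [lt_div_iff₀ hs]
      linarith
    have hb : 0 ≤ Λ * (2 / √Λ) ^ 3 - 3 * (2 / √Λ) + 6 * m := by
      have : Λ * (2 / √Λ) ^ 3 = 8 / √Λ := by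
        field_simp
        nlinarith
      rw [this]
      have : 8 / √Λ - 3 * (2 / √Λ) = 2 / √Λ := by ring
      have h3 : 0 < 2 / √Λ := by positivity
      linarith
    obtain ⟨r, hr, h⟩ := intermediate_value_Icc hle hcont ⟨ha, hb⟩
    refine ⟨r, ?_, h⟩
    have h3 : 3 * m < 1 / √Λ := by rwa [lt_div_iff₀ hs]
    linarith [hr.1]
  exact hclosed.isGreatest_csSup hne hbdd

end

end SdS

namespace SdS

noncomputable section

section Warp

variable {Λ m a r : ℝ}

theorem hasDerivAt_warp (hr : r ≠ 0) :
    HasDerivAt (warp Λ m) (2 * Λ * r / 3 - 2 * m / r ^ 2) r := by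
  have hquadratic : HasDerivAt (fun s : ℝ => Λ * s ^ 2 / 3) (Λ * (2 * r) / 3) r := by
    simpa using ((hasDerivAt_pow 2 r).const_mul Λ).div_const 3
  have hinverse : HasDerivAt (fun s : ℝ => 2 * m / s) (2 * m * -(r ^ 2)⁻¹) r := by
    simpa only [div_eq_mul_inv] using (hasDerivAt_inv hr).const_mul (2 * m)
  exact ((hquadratic.add hinverse).sub_const 1).congr_deriv (by ring)

theorem mul_deriv_warp (hr : r ≠ 0) :
    r * deriv (warp Λ m) r = 2 * warp Λ m r + 2 * (r - 3 * m) / r := by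
  rw [(hasDerivAt_warp hr).deriv, warp]
  field_simp
  ring

theorem warp_div_sq_strictMonoOn (ha : 0 < a) (ham : 3 * m ≤ a) :
    StrictMonoOn (fun s => warp Λ m s / s ^ 2) (Set.Ici a) := by
  have hderiv : ∀ s, 0 < s →
      HasDerivAt (fun s => warp Λ m s / s ^ 2) (2 * (s - 3 * m) / s ^ 4) s := fun s hs =>
    ((hasDerivAt_warp hs.ne').div (hasDerivAt_pow 2 s) (by positivity)).congr_deriv (by
      rw [warp]
      field_simp
      ring)
  refine strictMonoOn_of_hasDerivWithinAt_pos (convex_Ici a)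
    (fun s hs => (hderiv s (ha.trans_le hs)).continuousAt.continuousWithinAt)
    (fun s hs => (hderiv s (ha.trans_le (interior_subset hs))).hasDerivWithinAt) fun s hs => ?_
  rw [interior_Ici, Set.mem_Ioi] at hs
  have : 0 < s := ha.trans hs
  have : 0 < s - 3 * m := by linarith
  positivity

theorem warp_pos (ha : 0 < a) (ham : 3 * m ≤ a) (hFa : 0 ≤ warp Λ m a) (hr : a < r) :
    0 < warp Λ m r := by
  have hlt := warp_div_sq_strictMonoOn (Λ := Λ) ha ham Set.self_mem_Ici hr.le hr
  have : 0 < warp Λ m r / r ^ 2 := (by positivity : 0 ≤ warp Λ m a / a ^ 2).trans_lt hlt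
  have hr₀ : 0 < r := ha.trans hr
  simpa [hr₀.ne'] using mul_pos this (pow_pos hr₀ 2)

theorem monotoneOn_warp (ha : 0 < a) (ham : 3 * m ≤ a) (hFa : 0 ≤ warp Λ m a) :
    MonotoneOn (warp Λ m) (Set.Ioi a) := by
  intro s hs t ht hst
  have hs₀ : 0 < s := ha.trans hs
  have ht₀ : 0 < t := ha.trans ht
  have hle := (warp_div_sq_strictMonoOn (Λ := Λ) ha ham).monotoneOn
    (Set.Ioi_subset_Ici_self hs) (Set.Ioi_subset_Ici_self ht) hst
  have hFs : 0 ≤ warp Λ m s / s ^ 2 := div_nonneg (warp_pos ha ham hFa hs).le (sq_nonneg s)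
  calc warp Λ m s = s ^ 2 * (warp Λ m s / s ^ 2) := by field_simp
    _ ≤ t ^ 2 * (warp Λ m t / t ^ 2) := by gcongr
    _ = warp Λ m t := by field_simp

theorem lapse_sq (hF : 0 < warp Λ m r) : lapse Λ m r ^ 2 = (warp Λ m r)⁻¹ := by
  rw [lapse, div_pow, Real.sq_sqrt hF.le, one_pow, one_div]

theorem three_mul_le_cosmologicalRadius (hΛ : 0 < Λ) (hm : 0 < m) (hsub : 3 * m * √Λ < 1) :
    3 * m ≤ cosmologicalRadius Λ m := by
  have hs : 0 < √Λ := Real.sqrt_pos.2 hΛ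
  have hsq : Λ = √Λ ^ 2 := (Real.sq_sqrt hΛ.le).symm
  have hneg : warp Λ m (3 * m) ≤ 0 := by
    have : warp Λ m (3 * m) = ((3 * m * √Λ) ^ 2 - 1) / 3 := by
      rw [warp, mul_pow _ √Λ, ← hsq]
      field_simp
      ring
    nlinarith [mul_pos hm hs]
  have hpos : 0 ≤ warp Λ m (2 / √Λ) := by
    have : warp Λ m (2 / √Λ) = 1 / 3 + m * √Λ := by
      rw [warp, div_pow, ← hsq]
      field_simp
      ring
    rw [this]
    positivity
  have hle : 3 * m ≤ 2 / √Λ := by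
    rw [le_div_iff₀ hs]
    linarith
  have hcont : ContinuousOn (warp Λ m) (Set.Icc (3 * m) (2 / √Λ)) := fun r hr =>
    (hasDerivAt_warp (by linarith [hr.1] : 0 < r).ne').continuousAt.continuousWithinAt
  obtain ⟨r, hr, hroot⟩ := intermediate_value_Icc hle hcont ⟨hneg, hpos⟩
  exact hr.1.trans
    ((isGreatest_cosmologicalRadius hΛ hm hsub).2 ⟨by linarith [hr.1], hroot⟩)

end Warp

section Divergence

variable {E : Type*} [NormedAddCommGroup E] [NormedSpace ℝ E]

/-- The divergence of a vector field on a vector space: the trace of its derivative, i.e.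
`∑ μ, ∂_μ W^μ` in any linear coordinates. -/
def divergence (W : E → E) (p : E) : ℝ := LinearMap.trace ℝ E (fderiv ℝ W p)

variable {W W' : E → E} {p : E}

theorem divergence_sub (hW : DifferentiableAt ℝ W p) (hW' : DifferentiableAt ℝ W' p) :
    divergence (fun q => W q - W' q) p = divergence W p - divergence W' p := by
  rw [divergence, fderiv_fun_sub hW hW', ContinuousLinearMap.toLinearMap_sub, map_sub]
  rfl

variable [FiniteDimensional ℝ E]

theorem divergence_smul {f : E → ℝ} (hf : DifferentiableAt ℝ f p) (hW : DifferentiableAt ℝ W p) :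
    divergence (fun q => f q • W q) p = f p * divergence W p + fderiv ℝ f p (W p) := by
  rw [divergence, fderiv_fun_smul hf hW, ContinuousLinearMap.toLinearMap_add, map_add,
    ContinuousLinearMap.toLinearMap_smul, map_smul, smul_eq_mul, divergence]
  congr 1
  exact LinearMap.trace_smulRight (fderiv ℝ f p : E →ₗ[ℝ] ℝ) (W p)

variable [MeasurableSpace E] [BorelSpace E] (μ : Measure E) [μ.IsAddHaarMeasure]

theorem integral_fderiv_eq_zero {F : Type*} [NormedAddCommGroup F] [NormedSpace ℝ F]
    [CompleteSpace F] {f : E → F} (hf : ContDiff ℝ 1 f) (hc : HasCompactSupport f) :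
    ∫ p, fderiv ℝ f p ∂μ = 0 := by
  have hint : Integrable (fderiv ℝ f) μ :=
    (hf.continuous_fderiv one_ne_zero).integrable_of_hasCompactSupport (hc.fderiv ℝ)
  ext v
  rw [ContinuousLinearMap.integral_apply hint]
  simpa using integral_smul_fderiv_eq_neg_fderiv_smul_of_integrable (μ := μ) (𝕜 := ℝ) (v := v)
    (f := fun _ => 1) (g := f) (by simp) (by simpa using hint.apply_continuousLinearMap v)
    (by simpa using hf.continuous.integrable_of_hasCompactSupport hc)
    (fun _ _ => differentiableAt_const _) (fun p _ => hf.differentiable one_ne_zero p)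

/-- The trace as a continuous linear functional on endomorphisms. -/
def traceCLM (E : Type*) [NormedAddCommGroup E] [NormedSpace ℝ E] [FiniteDimensional ℝ E] :
    (E →L[ℝ] E) →L[ℝ] ℝ :=
  (LinearMap.trace ℝ E ∘ₗ ContinuousLinearMap.coeLM ℝ).toContinuousLinearMap

theorem integrable_divergence (hW : ContDiff ℝ 1 W) (hc : HasCompactSupport W) :
    Integrable (divergence W) μ :=
  (traceCLM E).integrable_comp
    ((hW.continuous_fderiv one_ne_zero).integrable_of_hasCompactSupport (hc.fderiv ℝ))

theorem integral_divergence_eq_zero (hW : ContDiff ℝ 1 W) (hc : HasCompactSupport W) :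
    ∫ p, divergence W p ∂μ = 0 := by
  have hint : Integrable (fderiv ℝ W) μ :=
    (hW.continuous_fderiv one_ne_zero).integrable_of_hasCompactSupport (hc.fderiv ℝ)
  calc ∫ p, divergence W p ∂μ = traceCLM E (∫ p, fderiv ℝ W p ∂μ) :=
        (traceCLM E).integral_comp_comm hint
    _ = 0 := by rw [integral_fderiv_eq_zero μ hW hc, map_zero]

end Divergence

section Chart

variable {p : Spacetime}

theorem contDiffAt_radius (hp : 0 < radius p) {n : WithTop ℕ∞} : ContDiffAt ℝ n radius p :=
  (contDiffAt_norm ℝ (norm_pos_iff.1 hp)).comp p contDiff_snd.contDiffAt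

theorem continuous_radius : Continuous radius := continuous_snd.norm

theorem fderiv_radius (hp : 0 < radius p) (v : Spacetime) : fderiv ℝ radius p v = dR p v := by
  have hsqrt := ((hasFDerivAt_snd (𝕜 := ℝ) (p := p)).norm_sq).sqrt (pow_ne_zero 2 hp.ne')
  have hradius : (fun q : Spacetime => √(‖q.2‖ ^ 2)) = radius :=
    funext fun q => Real.sqrt_sq (norm_nonneg q.2)
  rw [hradius] at hsqrt
  rw [hsqrt.fderiv, dR, ← congrFun hradius p]
  simp only [norm_nonneg, Real.sqrt_sq, one_div, mul_inv_rev, smul_apply,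
    ContinuousLinearMap.comp_apply, ContinuousLinearMap.coe_snd', coe_innerSL_apply, nsmul_eq_mul,
    Nat.cast_ofNat, smul_eq_mul]
  ring

theorem contDiffAt_vecR (hp : 0 < radius p) {n : WithTop ℕ∞} : ContDiffAt ℝ n vecR p :=
  contDiffAt_const.prodMk (((contDiffAt_radius hp).inv hp.ne').smul contDiff_snd.contDiffAt)

theorem fderiv_vecR (hp : 0 < radius p) (v : Spacetime) :
    fderiv ℝ vecR p v = (radius p)⁻¹ • ((0, v.2) - dR p v • vecR p) := by
  have hradius := ((contDiffAt_radius hp (n := 1)).differentiableAt one_ne_zero).hasFDerivAt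
  have hvecR := (hasFDerivAt_const (0 : ℝ) p).prodMk
    (((hasDerivAt_inv hp.ne').comp_hasFDerivAt p hradius).smul (hasFDerivAt_snd (𝕜 := ℝ) (p := p)))
  rw [HasFDerivAt.fderiv (f := vecR) hvecR]
  ext
  · simp [vecR]
  · simp only [Function.comp_apply, neg_smul, ContinuousLinearMap.prod_apply, zero_apply, add_apply,
      smul_apply, ContinuousLinearMap.coe_snd', ContinuousLinearMap.smulRight_apply, neg_apply,
      fderiv_radius hp, smul_eq_mul, PiLp.add_apply, PiLp.smul_apply, PiLp.neg_apply, vecR,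
      Prod.smul_mk, mul_zero, Prod.mk_sub_mk, sub_self, PiLp.sub_apply]
    field_simp
    ring

theorem dR_vecR (hp : 0 < radius p) : dR p (vecR p) = 1 := by
  rw [dR, vecR, inner_smul_right, real_inner_self_eq_norm_sq, ← radius]
  field_simp

theorem norm_vecR (hp : 0 < radius p) : ‖(vecR p).2‖ = 1 := by
  rw [vecR, norm_smul, norm_inv, Real.norm_of_nonneg hp.le]
  exact inv_mul_cancel₀ hp.ne'

theorem divergence_vecR (hp : 0 < radius p) : divergence vecR p = 2 / radius p := by
  have hfderiv : (fderiv ℝ vecR p : Spacetime →ₗ[ℝ] Spacetime) = (radius p)⁻¹ •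
      (LinearMap.inr ℝ ℝ E3 ∘ₗ LinearMap.snd ℝ ℝ E3
        - (fderiv ℝ radius p : Spacetime →ₗ[ℝ] ℝ).smulRight (vecR p)) :=
    LinearMap.ext fun v => by
      simpa [fderiv_radius hp] using fderiv_vecR hp v
  rw [divergence, hfderiv, map_smul, map_sub, LinearMap.trace_comp_comm',
    LinearMap.snd_comp_inr, LinearMap.trace_id, LinearMap.trace_smulRight, finrank_euclideanSpace,
    ContinuousLinearMap.coe_coe, fderiv_radius hp, dR_vecR hp, Fintype.card_fin, smul_eq_mul]
  push_cast
  ring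

end Chart

section Frame

/-- The coordinate frame `∂_0, …, ∂_3` as a basis of the model space. -/
def frameBasis : Module.Basis (Fin 4) ℝ Spacetime :=
  .ofEquivFun (((LinearEquiv.refl ℝ ℝ).prodCongr (WithLp.linearEquiv 2 ℝ (Fin 3 → ℝ))).trans
    (Fin.consLinearEquiv ℝ fun _ : Fin 4 => ℝ))

theorem frameBasis_repr_zero (v : Spacetime) : frameBasis.repr v 0 = v.1 := rfl

theorem frameBasis_repr_succ (v : Spacetime) (i : Fin 3) : frameBasis.repr v i.succ = v.2 i := rfl

theorem frameBasis_apply (μ : Fin 4) : frameBasis μ = frame μ := by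
  refine frameBasis.repr.injective (Finsupp.ext fun ν => ?_)
  rw [frameBasis.repr_self]
  cases μ using Fin.cases <;> cases ν using Fin.cases <;>
    simp [frameBasis_repr_zero, frameBasis_repr_succ, frame, Finsupp.single_apply,
      eq_comm, Fin.succ_ne_zero]

theorem divergence_eq_sum_partialDeriv {W : Spacetime → Spacetime} {p : Spacetime}
    (hW : DifferentiableAt ℝ W p) :
    divergence W p = ∑ μ, partialDeriv μ (fun q => frameBasis.repr (W q) μ) p := by
  rw [divergence, LinearMap.trace_eq_matrix_trace ℝ frameBasis, Matrix.trace]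
  refine Finset.sum_congr rfl fun μ _ => ?_
  rw [Matrix.diag_apply, LinearMap.toMatrix_apply, frameBasis_apply, partialDeriv]
  have hcoord := (frameBasis.coord μ).toContinuousLinearMap.hasFDerivAt.comp p hW.hasFDerivAt
  exact (congrArg (fun A => A (frame μ)) hcoord.fderiv).symm

variable {Λ m : ℝ} {p : Spacetime}

theorem isLinearMap_metric (v : Spacetime) : IsLinearMap ℝ (metric Λ m p v) where
  map_add w w' := by
    simp only [metric, sphereForm, dR, dT, Prod.fst_add, Prod.snd_add, inner_add_right]
    ring
  map_smul c w := by
    simp only [metric, sphereForm, dR, dT, Prod.smul_fst, Prod.smul_snd, inner_smul_right,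
      smul_eq_mul]
    ring

theorem metricMatrix_mulVec_repr (v : Spacetime) (μ : Fin 4) :
    (metricMatrix Λ m p).mulVec (frameBasis.repr v) μ = metric Λ m p (frame μ) v := by
  let metricForm := (isLinearMap_metric (Λ := Λ) (m := m) (p := p) (frame μ)).mk'
  calc (metricMatrix Λ m p).mulVec (frameBasis.repr v) μ
      = ∑ ν, frameBasis.repr v ν • metricForm (frameBasis ν) :=
        by simp only [frameBasis_apply, smul_eq_mul, mul_comm (frameBasis.repr v _)]; rfl
    _ = metricForm (∑ ν, frameBasis.repr v ν • frameBasis ν) := by simp only [map_sum, map_smul]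
    _ = metric Λ m p (frame μ) v := by rw [frameBasis.sum_repr]; rfl

theorem metricMatrix_zero_zero : metricMatrix Λ m p 0 0 = warp Λ m (radius p) := by
  simp [metricMatrix, metric, frame, dR, dT, sphereForm]

theorem metricMatrix_zero_succ (i : Fin 3) : metricMatrix Λ m p 0 i.succ = 0 := by
  simp [metricMatrix, metric, frame, dR, dT, sphereForm]

theorem metricMatrix_submatrix_succ (hF : 0 < warp Λ m (radius p)) :
    (metricMatrix Λ m p).submatrix Fin.succ Fin.succ =
      1 + Matrix.replicateCol Unit (fun i => -(1 + (warp Λ m (radius p))⁻¹) * (vecR p).2 i) *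
        Matrix.replicateRow Unit (fun i => (vecR p).2 i) := by
  ext i j
  simp only [metricMatrix, metric, lapse_sq hF, dR, frame, neg_mul, dT, sphereForm,
    Matrix.submatrix_apply, Matrix.of_apply, Fin.cons_succ, EuclideanSpace.inner_single_right,
    Real.ringHom_apply, one_mul, mul_zero, add_zero, PiLp.single_apply,
    MonoidWithZeroHom.map_ite_one_zero, mul_ite, mul_one, neg_add_rev, vecR, PiLp.smul_apply,
    smul_eq_mul, Matrix.add_apply, Matrix.one_apply, eq_comm (a := i), Matrix.mul_apply,
    Finset.univ_unique, PUnit.default_eq_unit, Matrix.replicateCol_apply,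
    Matrix.replicateRow_apply, Finset.sum_const, Finset.card_singleton, one_smul]
  split_ifs <;> ring

theorem det_metricMatrix (hp : 0 < radius p) (hF : 0 < warp Λ m (radius p)) :
    (metricMatrix Λ m p).det = -1 := by
  have hn : ∑ i, (vecR p).2 i * (vecR p).2 i = 1 := by
    have hinner := real_inner_self_eq_norm_sq (vecR p).2
    rwa [norm_vecR hp, one_pow, PiLp.inner_apply] at hinner
  rw [Matrix.det_succ_row_zero, Fin.sum_univ_succ]
  simp only [metricMatrix_zero_zero, metricMatrix_zero_succ, mul_zero, zero_mul,
    Finset.sum_const_zero, add_zero, Fin.val_zero, pow_zero, one_mul, Fin.succAbove_zero]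
  rw [metricMatrix_submatrix_succ hF, Matrix.det_one_add_replicateCol_mul_replicateRow, dotProduct]
  simp_rw [mul_left_comm _ (-_ : ℝ), ← Finset.mul_sum]
  rw [hn]
  field_simp
  ring

end Frame

section Gradient

/-- The radial derivative `∂_r ψ`. -/
def radialDeriv (ψ : Spacetime → ℝ) (p : Spacetime) : ℝ := fderiv ℝ ψ p (vecR p)

/-- The Euclidean gradient of `ψ` in the space variable `x`. -/
def spatialGradient (ψ : Spacetime → ℝ) (p : Spacetime) : E3 :=
  (InnerProductSpace.toDual ℝ E3).symm (fderiv ℝ ψ p ∘L ContinuousLinearMap.inr ℝ ℝ E3)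

/-- The gradient of `ψ` with respect to the Schwarzschild de Sitter metric. -/
def gradientVector (Λ m : ℝ) (ψ : Spacetime → ℝ) (p : Spacetime) : Spacetime :=
  ((warp Λ m (radius p))⁻¹ * fderiv ℝ ψ p vecT,
    spatialGradient ψ p - ((1 + warp Λ m (radius p)) * radialDeriv ψ p) • (vecR p).2)

variable {Λ m : ℝ} {ψ : Spacetime → ℝ} {p : Spacetime}

theorem inner_spatialGradient (v : E3) : inner ℝ (spatialGradient ψ p) v = fderiv ℝ ψ p (0, v) :=
  InnerProductSpace.toDual_symm_apply

theorem apply_eq_fst_mul_vecT_add (A : Spacetime →L[ℝ] ℝ) (v : Spacetime) :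
    A v = v.1 * A vecT + A (0, v.2) := by
  rw [← smul_eq_mul, ← map_smul, ← map_add]
  simp [vecT]

theorem fderiv_eq_add_inner_spatialGradient (v : Spacetime) :
    fderiv ℝ ψ p v = v.1 * fderiv ℝ ψ p vecT + inner ℝ (spatialGradient ψ p) v.2 := by
  rw [inner_spatialGradient, apply_eq_fst_mul_vecT_add]

theorem dR_eq_inner_vecR (v : Spacetime) : dR p v = inner ℝ (vecR p).2 v.2 := by
  rw [dR, vecR, real_inner_smul_left, div_eq_inv_mul]

theorem inner_vecR_spatialGradient :
    inner ℝ (vecR p).2 (spatialGradient ψ p) = radialDeriv ψ p := by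
  rw [real_inner_comm, inner_spatialGradient]
  rfl

theorem dR_gradientVector (hp : 0 < radius p) :
    dR p (gradientVector Λ m ψ p) = -(warp Λ m (radius p) * radialDeriv ψ p) := by
  rw [dR_eq_inner_vecR, gradientVector, inner_sub_right, inner_smul_right,
    real_inner_self_eq_norm_sq, norm_vecR hp, inner_vecR_spatialGradient]
  ring

theorem metric_gradientVector (hp : 0 < radius p) (hF : 0 < warp Λ m (radius p)) (v : Spacetime) :
    metric Λ m p v (gradientVector Λ m ψ p) = fderiv ℝ ψ p v := by
  rw [metric, lapse_sq hF, sphereForm, dR_gradientVector hp, fderiv_eq_add_inner_spatialGradient,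
    gradientVector, inner_sub_right, inner_smul_right, real_inner_comm (vecR p).2,
    ← dR_eq_inner_vecR, dT, dT, real_inner_comm v.2]
  field_simp
  ring

theorem inv_metricMatrix_mulVec (hp : 0 < radius p) (hF : 0 < warp Λ m (radius p)) :
    (metricMatrix Λ m p)⁻¹.mulVec (fun ν => partialDeriv ν ψ p) =
      frameBasis.repr (gradientVector Λ m ψ p) := by
  have hlower : (fun ν => partialDeriv ν ψ p) =
      (metricMatrix Λ m p).mulVec (frameBasis.repr (gradientVector Λ m ψ p)) :=
    funext fun ν => by
      rw [metricMatrix_mulVec_repr, metric_gradientVector hp hF, partialDeriv]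
  rw [hlower, Matrix.mulVec_mulVec, Matrix.nonsing_inv_mul, Matrix.one_mulVec]
  simp [det_metricMatrix hp hF]

theorem contDiffAt_warp_radius (hp : 0 < radius p) {n : WithTop ℕ∞} :
    ContDiffAt ℝ n (fun q => warp Λ m (radius q)) p := by
  have hradius := contDiffAt_radius hp (n := n)
  unfold warp
  exact (((contDiffAt_const.mul (hradius.pow 2)).div_const _).add
    (contDiffAt_const.div hradius hp.ne')).sub contDiffAt_const

theorem eventually_warp_radius_pos (hp : 0 < radius p) (hF : 0 < warp Λ m (radius p)) :
    ∀ᶠ q in nhds p, 0 < radius q ∧ 0 < warp Λ m (radius q) :=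
  (continuous_radius.continuousAt.eventually_const_lt hp).and
    ((contDiffAt_warp_radius hp (n := 0)).continuousAt.eventually_const_lt hF)

theorem contDiffAt_radialDeriv (hψ : ContDiffAt ℝ 2 ψ p) (hp : 0 < radius p) :
    ContDiffAt ℝ 1 (radialDeriv ψ) p :=
  (hψ.fderiv_right (by norm_num)).clm_apply (contDiffAt_vecR hp)

theorem contDiffAt_spatialGradient (hψ : ContDiffAt ℝ 2 ψ p) :
    ContDiffAt ℝ 1 (spatialGradient ψ) p :=
  (InnerProductSpace.toDual ℝ E3).symm.contDiff.contDiffAt.comp p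
    ((hψ.fderiv_right (by norm_num)).clm_comp contDiffAt_const)

theorem contDiffAt_gradientVector (hψ : ContDiffAt ℝ 2 ψ p) (hp : 0 < radius p)
    (hF : 0 < warp Λ m (radius p)) : ContDiffAt ℝ 1 (gradientVector Λ m ψ) p := by
  have hwarp := contDiffAt_warp_radius (Λ := Λ) (m := m) hp (n := 1)
  exact ((hwarp.inv hF.ne').mul ((hψ.fderiv_right (by norm_num)).clm_apply contDiffAt_const)).prodMk
    ((contDiffAt_spatialGradient hψ).sub (((contDiffAt_const.add hwarp).mul
      (contDiffAt_radialDeriv hψ hp)).smul (contDiffAt_vecR hp).snd))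

theorem waveOperator_eq_divergence (hψ : ContDiffAt ℝ 2 ψ p) (hp : 0 < radius p)
    (hF : 0 < warp Λ m (radius p)) :
    waveOperator Λ m ψ p = divergence (gradientVector Λ m ψ) p := by
  have hgradient : ∀ μ, (fun q => √|(metricMatrix Λ m q).det| *
      ∑ ν, (metricMatrix Λ m q)⁻¹ μ ν * partialDeriv ν ψ q) =ᶠ[nhds p]
      fun q => frameBasis.repr (gradientVector Λ m ψ q) μ := fun μ => by
    filter_upwards [eventually_warp_radius_pos hp hF] with q hq
    rw [det_metricMatrix hq.1 hq.2, abs_neg, abs_one, Real.sqrt_one, one_mul,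
      ← inv_metricMatrix_mulVec hq.1 hq.2]
    rfl
  rw [waveOperator, divergence_eq_sum_partialDeriv
      ((contDiffAt_gradientVector hψ hp hF).differentiableAt one_ne_zero),
    det_metricMatrix hp hF, abs_neg, abs_one, Real.sqrt_one, inv_one, one_mul]
  exact Finset.sum_congr rfl fun μ _ =>
    congrArg (fun A : Spacetime →L[ℝ] ℝ => A (frame μ)) (hgradient μ).fderiv_eq

end Gradient

section Current

/-- The Lagrangian density `g(∇ψ, ∇ψ)` of the wave equation. -/
def lagrangian (Λ m : ℝ) (ψ : Spacetime → ℝ) (p : Spacetime) : ℝ :=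
  fderiv ℝ ψ p (gradientVector Λ m ψ p)

/-- The energy current of the multiplier `∂_r`: the vector field
`(∂_r ψ) ∇ψ - g(∇ψ, ∇ψ) / 2 ∂_r` obtained from the energy-momentum tensor of `ψ`. -/
def energyCurrent (Λ m : ℝ) (ψ : Spacetime → ℝ) (p : Spacetime) : Spacetime :=
  radialDeriv ψ p • gradientVector Λ m ψ p - (lagrangian Λ m ψ p / 2) • vecR p

variable {Λ m : ℝ} {ψ : Spacetime → ℝ} {p : Spacetime}

theorem lagrangian_eq : lagrangian Λ m ψ p = (warp Λ m (radius p))⁻¹ * fderiv ℝ ψ p vecT ^ 2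
    + ‖spatialGradient ψ p‖ ^ 2 - (1 + warp Λ m (radius p)) * radialDeriv ψ p ^ 2 := by
  rw [lagrangian, fderiv_eq_add_inner_spatialGradient, gradientVector, inner_sub_right,
    inner_smul_right, real_inner_self_eq_norm_sq, real_inner_comm, inner_vecR_spatialGradient]
  ring

theorem hasFDerivAt_fderiv (hψ : ContDiffAt ℝ 2 ψ p) :
    HasFDerivAt (fderiv ℝ ψ) (fderiv ℝ (fderiv ℝ ψ) p) p :=
  ((hψ.fderiv_right (m := 1) (by norm_num)).differentiableAt one_ne_zero).hasFDerivAt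

theorem fderiv_spatialGradient (hψ : ContDiffAt ℝ 2 ψ p) (v : Spacetime) (w : E3) :
    inner ℝ (fderiv ℝ (spatialGradient ψ) p v) w = fderiv ℝ (fderiv ℝ ψ) p v (0, w) := by
  let dual := (InnerProductSpace.toDual ℝ E3).symm
  have h := dual.toContinuousLinearEquiv.hasFDerivAt.comp p
    ((hasFDerivAt_fderiv hψ).clm_comp (hasFDerivAt_const (ContinuousLinearMap.inr ℝ ℝ E3) p))
  rw [HasFDerivAt.fderiv (f := spatialGradient ψ) h]
  simp [dual]

theorem fderiv_radialDeriv (hψ : ContDiffAt ℝ 2 ψ p) (hp : 0 < radius p) (v : Spacetime) :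
    fderiv ℝ (radialDeriv ψ) p v =
      fderiv ℝ (fderiv ℝ ψ) p v (vecR p) + fderiv ℝ ψ p (fderiv ℝ vecR p v) := by
  have h := (hasFDerivAt_fderiv hψ).clm_apply
    ((contDiffAt_vecR hp (n := 1)).differentiableAt one_ne_zero).hasFDerivAt
  rw [HasFDerivAt.fderiv (f := radialDeriv ψ) h]
  simp [add_comm]

theorem fderiv_vecR_self (hp : 0 < radius p) : fderiv ℝ vecR p (vecR p) = 0 := by
  rw [fderiv_vecR hp, dR_vecR hp, one_smul]
  simp [vecR]

theorem fderiv_radialDeriv_gradientVector (hψ : ContDiffAt ℝ 2 ψ p) (hp : 0 < radius p) :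
    fderiv ℝ (radialDeriv ψ) p (gradientVector Λ m ψ p) =
      fderiv ℝ (fderiv ℝ ψ) p (vecR p) (gradientVector Λ m ψ p)
        + (‖spatialGradient ψ p‖ ^ 2 - radialDeriv ψ p ^ 2) / radius p := by
  rw [fderiv_radialDeriv hψ hp, hψ.isSymmSndFDerivAt (by simp), fderiv_vecR hp,
    dR_gradientVector hp, map_smul, map_sub, map_smul, ← inner_spatialGradient, gradientVector,
    inner_sub_right, inner_smul_right, real_inner_self_eq_norm_sq, real_inner_comm,
    inner_vecR_spatialGradient, ← radialDeriv, smul_eq_mul, smul_eq_mul]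
  field_simp
  ring

theorem fderiv_fderiv_gradientVector (hψ : ContDiffAt ℝ 2 ψ p) (hp : 0 < radius p) :
    fderiv ℝ (fderiv ℝ ψ) p (vecR p) (gradientVector Λ m ψ p) =
      (warp Λ m (radius p))⁻¹ * fderiv ℝ ψ p vecT * fderiv ℝ (fderiv ℝ ψ) p (vecR p) vecT
        + inner ℝ (spatialGradient ψ p) (fderiv ℝ (spatialGradient ψ) p (vecR p))
        - (1 + warp Λ m (radius p)) * radialDeriv ψ p * fderiv ℝ (radialDeriv ψ) p (vecR p) := by
  rw [apply_eq_fst_mul_vecT_add, ← fderiv_spatialGradient hψ, gradientVector, inner_sub_right,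
    inner_smul_right, fderiv_spatialGradient hψ _ (vecR p).2, fderiv_radialDeriv hψ hp,
    fderiv_vecR_self hp, map_zero, real_inner_comm, add_zero, add_sub_assoc]
  rfl

theorem fderiv_lagrangian_vecR (hψ : ContDiffAt ℝ 2 ψ p) (hp : 0 < radius p)
    (hF : 0 < warp Λ m (radius p)) :
    fderiv ℝ (lagrangian Λ m ψ) p (vecR p) =
      2 * fderiv ℝ (fderiv ℝ ψ) p (vecR p) (gradientVector Λ m ψ p)
        - deriv (warp Λ m) (radius p) *
          ((fderiv ℝ ψ p vecT / warp Λ m (radius p)) ^ 2 + radialDeriv ψ p ^ 2) := by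
  have hradius := ((contDiffAt_radius hp (n := 1)).differentiableAt one_ne_zero).hasFDerivAt
  have hderiv := (hasDerivAt_warp (Λ := Λ) (m := m) hp.ne').differentiableAt.hasDerivAt
  have hwarp := hderiv.comp_hasFDerivAt p hradius
  have hinv := (hderiv.fun_inv hF.ne').comp_hasFDerivAt p hradius
  have htime := (hasFDerivAt_fderiv hψ).clm_apply (hasFDerivAt_const vecT p)
  have hspace := ((contDiffAt_spatialGradient hψ).differentiableAt one_ne_zero).hasFDerivAt
  have hradial := ((contDiffAt_radialDeriv hψ hp).differentiableAt one_ne_zero).hasFDerivAt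
  have hL := ((hinv.mul (htime.pow 2)).add hspace.norm_sq).sub
    (((hasFDerivAt_const 1 p).add hwarp).mul (hradial.pow 2))
  rw [HasFDerivAt.fderiv (f := lagrangian Λ m ψ)
    (hL.congr_of_eventuallyEq (.of_forall fun q => lagrangian_eq)),
    fderiv_fderiv_gradientVector hψ hp]
  simp only [Function.comp_apply, Nat.add_one_sub_one, pow_one, nsmul_eq_mul, Nat.cast_ofNat,
    ContinuousLinearMap.comp_zero, zero_add, Pi.add_apply, sub_apply, add_apply, smul_apply,
    ContinuousLinearMap.flip_apply, smul_eq_mul, fderiv_radius hp, dR_vecR hp, mul_one,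
    ContinuousLinearMap.comp_apply, coe_innerSL_apply]
  field_simp
  ring

theorem contDiffAt_lagrangian (hψ : ContDiffAt ℝ 2 ψ p) (hp : 0 < radius p)
    (hF : 0 < warp Λ m (radius p)) : ContDiffAt ℝ 1 (lagrangian Λ m ψ) p :=
  (hψ.fderiv_right (by norm_num)).clm_apply (contDiffAt_gradientVector hψ hp hF)

theorem contDiffAt_energyCurrent (hψ : ContDiffAt ℝ 2 ψ p) (hp : 0 < radius p)
    (hF : 0 < warp Λ m (radius p)) : ContDiffAt ℝ 1 (energyCurrent Λ m ψ) p :=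
  ((contDiffAt_radialDeriv hψ hp).smul (contDiffAt_gradientVector hψ hp hF)).sub
    (((contDiffAt_lagrangian hψ hp hF).div_const 2).smul (contDiffAt_vecR hp))

theorem divergence_energyCurrent (hψ : ContDiffAt ℝ 2 ψ p) (hp : 0 < radius p)
    (hF : 0 < warp Λ m (radius p)) :
    divergence (energyCurrent Λ m ψ) p =
      radialDeriv ψ p * divergence (gradientVector Λ m ψ) p
        + (radius p * deriv (warp Λ m) (radius p) - 2 * warp Λ m (radius p)) / (2 * radius p)
          * (fderiv ℝ ψ p vecT / warp Λ m (radius p)) ^ 2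
        + (radius p * deriv (warp Λ m) (radius p) + 2 * warp Λ m (radius p)) / (2 * radius p)
          * radialDeriv ψ p ^ 2 := by
  have hV := (contDiffAt_gradientVector hψ hp hF).differentiableAt one_ne_zero
  have hX := (contDiffAt_vecR hp (n := 1)).differentiableAt one_ne_zero
  have ha := (contDiffAt_radialDeriv hψ hp).differentiableAt one_ne_zero
  have hL := (contDiffAt_lagrangian hψ hp hF).differentiableAt one_ne_zero
  have hL₂ := ((contDiffAt_lagrangian hψ hp hF).div_const 2).differentiableAt one_ne_zero
  have hhalf : fderiv ℝ (fun q => lagrangian Λ m ψ q / 2) p (vecR p) =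
      fderiv ℝ (lagrangian Λ m ψ) p (vecR p) / 2 := by
    simp only [div_eq_inv_mul, fderiv_const_mul hL, smul_apply, smul_eq_mul]
  unfold energyCurrent
  rw [divergence_sub (ha.fun_smul hV) (hL₂.fun_smul hX), divergence_smul ha hV,
    divergence_smul hL₂ hX, hhalf, fderiv_radialDeriv_gradientVector hψ hp,
    fderiv_lagrangian_vecR hψ hp hF, divergence_vecR hp, lagrangian_eq]
  field_simp
  ring

theorem divergence_energyCurrent_nonneg (hψ : ContDiffAt ℝ 2 ψ p) (hp : 0 < radius p)
    (hF : 0 < warp Λ m (radius p)) (hm : 3 * m ≤ radius p) (hwave : waveOperator Λ m ψ p = 0) :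
    0 ≤ divergence (energyCurrent Λ m ψ) p := by
  rw [divergence_energyCurrent hψ hp hF, ← waveOperator_eq_divergence hψ hp hF, hwave,
    mul_deriv_warp hp.ne']
  have : 0 ≤ 2 * (radius p - 3 * m) / radius p := by
    have := sub_nonneg.2 hm
    positivity
  have htime : 0 ≤ 2 * warp Λ m (radius p) + 2 * (radius p - 3 * m) / radius p
      - 2 * warp Λ m (radius p) := by linarith
  rw [mul_zero, zero_add]
  positivity

end Current

section EnergyDensity

variable {Λ m C : ℝ} {ψ : Spacetime → ℝ} {p : Spacetime}

theorem gradient_slice_eq_spatialGradient (hψ : DifferentiableAt ℝ ψ p) :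
    gradient (fun x : E3 => ψ (p.1, x)) p.2 = spatialGradient ψ p := by
  have hslice : HasFDerivAt (fun x : E3 => ψ (p.1, x))
      (fderiv ℝ ψ p ∘L ContinuousLinearMap.inr ℝ ℝ E3) p.2 :=
    HasFDerivAt.comp (g := ψ) p.2 hψ.hasFDerivAt (hasFDerivAt_prodMk_right p.1 p.2)
  rw [gradient, hslice.fderiv, spatialGradient]

theorem norm_sq_angularGradient (hψ : DifferentiableAt ℝ ψ p) (hp : 0 < radius p) :
    ‖angularGradient ψ p‖ ^ 2 = ‖spatialGradient ψ p‖ ^ 2 - radialDeriv ψ p ^ 2 := by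
  have hradial : ‖(ℝ ∙ p.2).starProjection (spatialGradient ψ p)‖ ^ 2 = radialDeriv ψ p ^ 2 := by
    rw [Submodule.starProjection_singleton, ← inner_vecR_spatialGradient, vecR,
      real_inner_smul_left, norm_smul, mul_pow, Real.norm_eq_abs, sq_abs, ← radius,
      RCLike.ofReal_real_eq_id, id]
    field_simp
  rw [angularGradient, gradient_slice_eq_spatialGradient hψ, ← hradial,
    Submodule.norm_sq_eq_add_norm_sq_starProjection (spatialGradient ψ p) (ℝ ∙ p.2),
    add_sub_cancel_left]

theorem energyDensity_eq (hψ : DifferentiableAt ℝ ψ p) (hp : 0 < radius p)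
    (hF : 0 < warp Λ m (radius p)) :
    energyDensity Λ m ψ p = warp Λ m (radius p) * radialDeriv ψ p ^ 2
      + (warp Λ m (radius p))⁻¹ * fderiv ℝ ψ p vecT ^ 2
      + (‖spatialGradient ψ p‖ ^ 2 - radialDeriv ψ p ^ 2) := by
  rw [energyDensity, lapse_sq hF, norm_sq_angularGradient hψ hp, one_div, inv_inv, radialDeriv]

theorem energyDensity_nonneg (Λ m : ℝ) (ψ : Spacetime → ℝ) (p : Spacetime) :
    0 ≤ energyDensity Λ m ψ p := by
  rw [energyDensity]
  positivity

theorem two_mul_abs_mul_le_energyDensity (hF : 0 < warp Λ m (radius p)) :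
    2 * |radialDeriv ψ p * fderiv ℝ ψ p vecT| ≤ energyDensity Λ m ψ p := by
  have hsq : √(warp Λ m (radius p)) ^ 2 = warp Λ m (radius p) := Real.sq_sqrt hF.le
  have hamgm := two_mul_le_add_sq (√(warp Λ m (radius p)) * |radialDeriv ψ p|)
    (|fderiv ℝ ψ p vecT| / √(warp Λ m (radius p)))
  have hroot : √(warp Λ m (radius p)) ≠ 0 := (Real.sqrt_pos.2 hF).ne'
  calc 2 * |radialDeriv ψ p * fderiv ℝ ψ p vecT|
      = 2 * (√(warp Λ m (radius p)) * |radialDeriv ψ p|) *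
          (|fderiv ℝ ψ p vecT| / √(warp Λ m (radius p))) := by
        rw [abs_mul]
        field_simp
    _ ≤ _ := hamgm
    _ = 1 / lapse Λ m (radius p) ^ 2 * radialDeriv ψ p ^ 2
          + lapse Λ m (radius p) ^ 2 * fderiv ℝ ψ p vecT ^ 2 := by
        rw [mul_pow, div_pow, hsq, sq_abs, sq_abs, lapse_sq hF, one_div, inv_inv, div_eq_inv_mul]
    _ ≤ energyDensity Λ m ψ p := le_add_of_nonneg_right (sq_nonneg _)

theorem dR_energyCurrent (hψ : DifferentiableAt ℝ ψ p) (hp : 0 < radius p)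
    (hF : 0 < warp Λ m (radius p)) :
    dR p (energyCurrent Λ m ψ p) = -(energyDensity Λ m ψ p / 2) := by
  rw [energyCurrent, dR_eq_inner_vecR, Prod.snd_sub, Prod.smul_snd, Prod.smul_snd, inner_sub_right,
    inner_smul_right, inner_smul_right, ← dR_eq_inner_vecR, ← dR_eq_inner_vecR, dR_vecR hp,
    dR_gradientVector hp, lagrangian_eq, energyDensity_eq hψ hp hF]
  ring

theorem abs_fst_energyCurrent_le (hF : 0 < warp Λ m (radius p))
    (hC : (warp Λ m (radius p))⁻¹ ≤ C) :
    |(energyCurrent Λ m ψ p).1| ≤ C * (energyDensity Λ m ψ p / 2) := by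
  have hfst : (energyCurrent Λ m ψ p).1 =
      (warp Λ m (radius p))⁻¹ * (radialDeriv ψ p * fderiv ℝ ψ p vecT) := by
    simp only [energyCurrent, gradientVector, vecR, Prod.fst_sub, Prod.smul_fst, smul_eq_mul]
    ring
  have hF' := inv_pos.2 hF
  rw [hfst, abs_mul, abs_of_pos hF']
  have := two_mul_abs_mul_le_energyDensity (ψ := ψ) hF
  gcongr
  · exact hF'.le.trans hC
  · linarith

end EnergyDensity

section ConeCutoff

variable {C R : ℝ} {p : Spacetime}

/-- A smooth cutoff in `t` at scale `R`, whose support shrinks with increasing `r` at speed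
`|dt/dr| ≥ C`. -/
def coneCutoff (C R : ℝ) (p : Spacetime) : ℝ :=
  Real.smoothTransition (R - √(1 + p.1 ^ 2) - C * radius p)

theorem coneCutoff_nonneg (C R : ℝ) (p : Spacetime) : 0 ≤ coneCutoff C R p :=
  Real.smoothTransition.nonneg _

theorem monotone_coneCutoff (C : ℝ) (p : Spacetime) : Monotone fun R => coneCutoff C R p :=
  fun _ _ h => Real.smoothTransition.monotone (by gcongr)

theorem coneCutoff_eq_zero (hC : 0 ≤ C) (h : R ≤ |p.1|) : coneCutoff C R p = 0 := by
  refine Real.smoothTransition.zero_of_nonpos ?_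
  have hsqrt : |p.1| ≤ √(1 + p.1 ^ 2) := Real.abs_le_sqrt (by linarith)
  have : 0 ≤ C * radius p := mul_nonneg hC (norm_nonneg _)
  linarith

theorem coneCutoff_eq_one (h : √(1 + p.1 ^ 2) + C * radius p + 1 ≤ R) : coneCutoff C R p = 1 :=
  Real.smoothTransition.one_of_one_le (by linarith)

theorem continuous_coneCutoff (C R : ℝ) : Continuous (coneCutoff C R) := by
  have := continuous_radius
  exact Real.smoothTransition.continuous.comp (by fun_prop)

theorem hasFDerivAt_sqrt_one_add_sq_fst (p : Spacetime) :
    HasFDerivAt (fun q : Spacetime => √(1 + q.1 ^ 2))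
      ((p.1 / √(1 + p.1 ^ 2)) • ContinuousLinearMap.fst ℝ ℝ E3) p := by
  have h := (((hasFDerivAt_fst (𝕜 := ℝ) (p := p)).pow 2).const_add 1).sqrt
    (by positivity : 1 + p.1 ^ 2 ≠ 0)
  refine h.congr_fderiv ?_
  ext
  · simp only [one_div, mul_inv_rev, Nat.add_one_sub_one, pow_one, nsmul_eq_mul, Nat.cast_ofNat,
      ContinuousLinearMap.smul_comp, ContinuousLinearMap.fst_comp_inl, smul_apply,
      ContinuousLinearMap.id_apply, smul_eq_mul, mul_one]
    field_simp
  · simp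

theorem contDiffAt_coneCutoff (hp : 0 < radius p) : ContDiffAt ℝ 1 (coneCutoff C R) p := by
  have hradius := contDiffAt_radius hp (n := 1)
  have hsqrt : ContDiffAt ℝ 1 (fun q : Spacetime => √(1 + q.1 ^ 2)) p :=
    ContDiffAt.sqrt (by fun_prop) (by positivity)
  exact (Real.smoothTransition.contDiff (n := 1)).contDiffAt.comp p
    ((contDiffAt_const.sub hsqrt).sub (contDiffAt_const.mul hradius))

theorem fderiv_coneCutoff_nonneg (hp : 0 < radius p) {v : Spacetime}
    (hv : |v.1| ≤ -(C * dR p v)) : 0 ≤ fderiv ℝ (coneCutoff C R) p v := by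
  have hradius := ((contDiffAt_radius hp (n := 1)).differentiableAt one_ne_zero).hasFDerivAt
  have hphase := ((hasFDerivAt_sqrt_one_add_sq_fst p).const_sub R).sub (hradius.const_mul C)
  have hcutoff := ((Real.smoothTransition.contDiff (n := 1)).differentiable one_ne_zero
    |>.differentiableAt.hasDerivAt).comp_hasFDerivAt p hphase
  rw [HasFDerivAt.fderiv (f := coneCutoff C R) hcutoff]
  refine mul_nonneg Real.smoothTransition.monotone.deriv_nonneg ?_
  have htime : |p.1 / √(1 + p.1 ^ 2) * v.1| ≤ |v.1| := by
    rw [abs_mul, abs_div, abs_of_nonneg (Real.sqrt_nonneg _)]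
    refine mul_le_of_le_one_left (abs_nonneg _) (div_le_one_of_le₀ ?_ (Real.sqrt_nonneg _))
    exact Real.abs_le_sqrt (by linarith)
  have := (le_abs_self _).trans (htime.trans hv)
  suffices 0 ≤ -(p.1 / √(1 + p.1 ^ 2) * v.1) - C * dR p v by simpa [fderiv_radius hp] using this
  linarith

end ConeCutoff

section WeightedCurrent

variable {Λ m C R : ℝ} {ψ : Spacetime → ℝ} {p : Spacetime} {ζ : ℝ → ℝ}

theorem contDiffAt_comp_radius_mul_coneCutoff (hζ : ContDiff ℝ 1 ζ) (hp : 0 < radius p) :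
    ContDiffAt ℝ 1 (fun q => ζ (radius q) * coneCutoff C R q) p :=
  (hζ.contDiffAt.comp p (contDiffAt_radius hp)).mul (contDiffAt_coneCutoff hp)

theorem fderiv_comp_radius_mul_coneCutoff (hζ : ContDiff ℝ 1 ζ) (hp : 0 < radius p)
    (v : Spacetime) :
    fderiv ℝ (fun q => ζ (radius q) * coneCutoff C R q) p v =
      ζ (radius p) * fderiv ℝ (coneCutoff C R) p v
        + coneCutoff C R p * (deriv ζ (radius p) * dR p v) := by
  have hradius := (contDiffAt_radius hp (n := 1)).differentiableAt one_ne_zero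
  have hcutoff := (contDiffAt_coneCutoff (C := C) (R := R) hp).differentiableAt one_ne_zero
  have hζradius : HasFDerivAt (fun q => ζ (radius q)) (deriv ζ (radius p) • fderiv ℝ radius p) p :=
    (hζ.differentiable one_ne_zero (radius p)).hasDerivAt.comp_hasFDerivAt p hradius.hasFDerivAt
  rw [(hζradius.fun_mul hcutoff.hasFDerivAt).fderiv, ← fderiv_radius hp]
  rfl

theorem neg_le_divergence_smul_energyCurrent (hψ : ContDiffAt ℝ 2 ψ p) (hp : 0 < radius p)
    (hF : 0 < warp Λ m (radius p)) (hm : 3 * m ≤ radius p) (hwave : waveOperator Λ m ψ p = 0)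
    (hC : (warp Λ m (radius p))⁻¹ ≤ C) (hζ : ContDiff ℝ 1 ζ) (hζ₀ : 0 ≤ ζ) :
    -(deriv ζ (radius p) * coneCutoff C R p * energyDensity Λ m ψ p / 2) ≤
      divergence (fun q => (ζ (radius q) * coneCutoff C R q) • energyCurrent Λ m ψ q) p := by
  have hflux := dR_energyCurrent (hψ.differentiableAt two_ne_zero) hp hF
  have hcone : 0 ≤ fderiv ℝ (coneCutoff C R) p (energyCurrent Λ m ψ p) :=
    fderiv_coneCutoff_nonneg hp (by simpa [hflux] using abs_fst_energyCurrent_le hF hC)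
  have hdiv := divergence_energyCurrent_nonneg hψ hp hF hm hwave
  have hbulk := mul_nonneg (mul_nonneg (hζ₀ (radius p)) (coneCutoff_nonneg C R p)) hdiv
  rw [divergence_smul
      ((contDiffAt_comp_radius_mul_coneCutoff hζ hp).differentiableAt one_ne_zero)
      ((contDiffAt_energyCurrent hψ hp hF).differentiableAt one_ne_zero),
    fderiv_comp_radius_mul_coneCutoff hζ hp, hflux]
  linarith [mul_nonneg (hζ₀ (radius p)) hcone]

end WeightedCurrent

section Distributional

/-- The smooth monotone step that rises from `0` to `1` on `[c, c + ε]`. -/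
def smoothStep (c ε r : ℝ) : ℝ := Real.smoothTransition ((r - c) / ε)

variable {c d ε r : ℝ}

theorem contDiff_smoothStep (c ε : ℝ) : ContDiff ℝ 1 (smoothStep c ε) :=
  Real.smoothTransition.contDiff.comp (by fun_prop)

theorem hasDerivAt_smoothStep (c ε r : ℝ) :
    HasDerivAt (smoothStep c ε) (deriv (smoothStep c ε) r) r :=
  ((contDiff_smoothStep c ε).differentiable one_ne_zero r).hasDerivAt

theorem monotone_smoothStep (hε : 0 < ε) : Monotone (smoothStep c ε) :=
  fun _ _ h => Real.smoothTransition.monotone (by gcongr)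

theorem smoothStep_le_smoothStep (hε : 0 < ε) (h : c ≤ d) : smoothStep d ε r ≤ smoothStep c ε r :=
  Real.smoothTransition.monotone (by gcongr)

theorem smoothStep_eq_zero (hε : 0 < ε) (h : r ≤ c) : smoothStep c ε r = 0 :=
  Real.smoothTransition.zero_of_nonpos (div_nonpos_of_nonpos_of_nonneg (by linarith) hε.le)

theorem smoothStep_eq_one (hε : 0 < ε) (h : c + ε ≤ r) : smoothStep c ε r = 1 :=
  Real.smoothTransition.one_of_one_le (by rw [one_le_div₀ hε]; linarith)

theorem deriv_smoothStep_eq_zero (hε : 0 < ε) (hr : r ∉ Set.Icc c (c + ε)) :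
    deriv (smoothStep c ε) r = 0 := by
  rcases not_and_or.1 hr with h | h
  · have hlocal : smoothStep c ε =ᶠ[nhds r] fun _ => 0 := by
      filter_upwards [eventually_lt_nhds (not_le.1 h)] with s hs using smoothStep_eq_zero hε hs.le
    rw [hlocal.deriv_eq, deriv_const]
  · have hlocal : smoothStep c ε =ᶠ[nhds r] fun _ => 1 := by
      filter_upwards [eventually_gt_nhds (not_le.1 h)] with s hs using smoothStep_eq_one hε hs.le
    rw [hlocal.deriv_eq, deriv_const]

theorem setIntegral_deriv_smoothStep (hε : 0 < ε) :
    ∫ r in Set.Icc c (c + ε), deriv (smoothStep c ε) r = 1 := by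
  have hle : c ≤ c + ε := by linarith
  rw [integral_Icc_eq_integral_Ioc, ← intervalIntegral.integral_of_le hle,
    intervalIntegral.integral_eq_sub_of_hasDerivAt (fun r _ => hasDerivAt_smoothStep c ε r)
      (((contDiff_smoothStep c ε).continuous_deriv le_rfl).intervalIntegrable _ _),
    smoothStep_eq_one hε le_rfl, smoothStep_eq_zero hε le_rfl, sub_zero]

theorem integrable_deriv_smoothStep_mul {G : ℝ → ℝ} (hε : 0 < ε)
    (hG : ContinuousOn G (Set.Icc c (c + ε))) :
    Integrable fun r => deriv (smoothStep c ε) r * G r :=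
  (integrableOn_iff_integrable_of_support_subset fun _ hr => by_contra fun h =>
    hr (mul_eq_zero_of_left (deriv_smoothStep_eq_zero hε h) _)).1
    (((contDiff_smoothStep c ε).continuous_deriv le_rfl).continuousOn.mul hG).integrableOn_Icc

theorem exists_integral_deriv_smoothStep_mul_eq {G : ℝ → ℝ} (hε : 0 < ε)
    (hG : ContinuousOn G (Set.Icc c (c + ε))) :
    ∃ ξ ∈ Set.Icc c (c + ε), ∫ r, deriv (smoothStep c ε) r * G r = G ξ := by
  have hderiv := (contDiff_smoothStep c ε).continuous_deriv le_rfl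
  obtain ⟨ξ, hξ, hmean⟩ := exists_eq_const_mul_setIntegral_of_nonneg (μ := volume)
    (isConnected_Icc (by linarith)) measurableSet_Icc hG hderiv.integrableOn_Icc
    (hG.mul hderiv.continuousOn).integrableOn_Icc
    fun _ _ => (monotone_smoothStep hε).deriv_nonneg
  refine ⟨ξ, hξ, ?_⟩
  rw [← setIntegral_eq_integral_of_forall_compl_eq_zero (s := Set.Icc c (c + ε)) fun r hr =>
      mul_eq_zero_of_left (deriv_smoothStep_eq_zero hε hr) _]
  simpa only [mul_comm, setIntegral_deriv_smoothStep hε, mul_one] using hmean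

theorem tsupport_smoothStep_sub_subset (hε : 0 < ε) (h : c ≤ d) :
    tsupport (fun r => smoothStep c ε r - smoothStep d ε r) ⊆ Set.Icc c (d + ε) := by
  refine closure_minimal (fun r hr => ⟨?_, ?_⟩) isClosed_Icc <;> by_contra! hlt <;> refine hr ?_
  · change smoothStep c ε r - smoothStep d ε r = 0
    rw [smoothStep_eq_zero hε hlt.le, smoothStep_eq_zero hε (hlt.le.trans h), sub_zero]
  · change smoothStep c ε r - smoothStep d ε r = 0
    rw [smoothStep_eq_one hε (by linarith), smoothStep_eq_one hε hlt.le, sub_self]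

theorem antitoneOn_of_integral_deriv_mul_nonneg {G : ℝ → ℝ} {a : ℝ}
    (hG : ContinuousOn G (Set.Ioi a))
    (h : ∀ ζ : ℝ → ℝ, ContDiff ℝ 1 ζ → 0 ≤ ζ → HasCompactSupport ζ → tsupport ζ ⊆ Set.Ioi a →
      0 ≤ ∫ r, deriv ζ r * G r) :
    AntitoneOn G (Set.Ioi a) := by
  intro c hc d hd hcd
  have hIcc : ∀ {b}, b ∈ Set.Ioi a → ∀ {e : ℝ}, ContinuousOn G (Set.Icc b e) := fun hb _ =>
    hG.mono fun _ hr => lt_of_lt_of_le hb hr.1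
  have hmean : ∀ n : ℕ, ∃ ξ ∈ Set.Icc c (c + 1 / (n + 1)), ∃ η ∈ Set.Icc d (d + 1 / (n + 1)),
      G η ≤ G ξ := by
    intro n
    have hε : (0 : ℝ) < 1 / (n + 1) := Nat.one_div_pos_of_nat
    obtain ⟨ξ, hξ, hξG⟩ := exists_integral_deriv_smoothStep_mul_eq hε (hIcc hc)
    obtain ⟨η, hη, hηG⟩ := exists_integral_deriv_smoothStep_mul_eq hε (hIcc hd)
    refine ⟨ξ, hξ, η, hη, sub_nonneg.1 ?_⟩
    have hsupp := tsupport_smoothStep_sub_subset hε hcd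
    have hpos := h _ ((contDiff_smoothStep c _).sub (contDiff_smoothStep d _))
      (fun _ => sub_nonneg.2 (smoothStep_le_smoothStep hε hcd))
      (isCompact_Icc.of_isClosed_subset (isClosed_tsupport _) hsupp)
      (hsupp.trans fun _ hr => lt_of_lt_of_le hc hr.1)
    simp only [((hasDerivAt_smoothStep c _ _).fun_sub (hasDerivAt_smoothStep d _ _)).deriv,
      sub_mul] at hpos
    rwa [integral_sub (integrable_deriv_smoothStep_mul hε (hIcc hc))
      (integrable_deriv_smoothStep_mul hε (hIcc hd)), hξG, hηG] at hpos
  choose ξ hξ η hη hle using hmean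
  have hlim : ∀ {b : ℝ}, b ∈ Set.Ioi a → ∀ {x : ℕ → ℝ},
      (∀ n : ℕ, x n ∈ Set.Icc b (b + 1 / (n + 1))) →
      Filter.Tendsto (fun n => G (x n)) Filter.atTop (nhds (G b)) := fun {b} hb x hx =>
    (hG.continuousAt (Ioi_mem_nhds hb)).tendsto.comp
      (tendsto_of_tendsto_of_tendsto_of_le_of_le tendsto_const_nhds
        (by simpa using tendsto_one_div_add_atTop_nhds_zero_nat.const_add b)
        (fun n => (hx n).1) fun n => (hx n).2)
  exact le_of_tendsto_of_tendsto' (hlim hd hη) (hlim hc hξ) hle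

end Distributional

section Slices

/-- The unit sphere of `E3`. -/
abbrev S2 : Type := Metric.sphere (0 : E3) 1

/-- The measure `dt dσ` on the cylinder `ℝ × S²`. -/
abbrev cylinderMeasure : Measure (ℝ × S2) :=
  (volume : Measure ℝ).prod (volume : Measure E3).toSphere

/-- The parametrization `(t, ω) ↦ (t, r ω)` of the level set `Σ_r` by the cylinder. -/
def sliceMap (r : ℝ) (z : ℝ × S2) : Spacetime := (z.1, r • (z.2 : E3))

variable {r : ℝ}

theorem radius_sliceMap (hr : 0 ≤ r) (z : ℝ × S2) : radius (sliceMap r z) = r := by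
  rw [radius, sliceMap, norm_smul, norm_eq_of_mem_sphere, mul_one, Real.norm_of_nonneg hr]

theorem continuous_uncurry_sliceMap : Continuous (Function.uncurry sliceMap) := by
  unfold Function.uncurry sliceMap
  fun_prop

theorem measurableEmbedding_sliceMap (hr : r ≠ 0) : MeasurableEmbedding (sliceMap r) :=
  MeasurableEmbedding.id.prodMap ((measurableEmbedding_const_smul₀ hr).comp
    (MeasurableEmbedding.subtype_coe Metric.isClosed_sphere.measurableSet))

theorem measurePreserving_smul_sphere :
    MeasurePreserving (fun y : S2 × Set.Ioi (0 : ℝ) => (y.2 : ℝ) • (y.1 : E3))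
      ((volume : Measure E3).toSphere.prod (Measure.volumeIoiPow 2)) volume := by
  have hpolar := MeasurePreserving.symm (homeomorphUnitSphereProd E3).toMeasurableEquiv
    (volume : Measure E3).measurePreserving_homeomorphUnitSphereProd
  rw [finrank_euclideanSpace_fin] at hpolar
  have hcoe := measurePreserving_subtype_coe (μa := (volume : Measure E3))
    (measurableSet_singleton (0 : E3)).compl
  rw [restrict_compl_singleton] at hcoe
  exact hcoe.comp hpolar

theorem measurePreserving_sliceMap :
    MeasurePreserving (fun y : (ℝ × S2) × Set.Ioi (0 : ℝ) => sliceMap y.2 y.1)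
      (cylinderMeasure.prod (Measure.volumeIoiPow 2)) volume :=
  ((MeasurePreserving.id (volume : Measure ℝ)).prod measurePreserving_smul_sphere).comp
    (measurePreserving_prodAssoc volume (volume : Measure E3).toSphere (Measure.volumeIoiPow 2))

theorem integral_eq_integral_sliceMap {f : Spacetime → ℝ} (hf : Integrable f) :
    ∫ p, f p = ∫ r in Set.Ioi (0 : ℝ), r ^ 2 * ∫ z, f (sliceMap r z) ∂cylinderMeasure := by
  have hmp := measurePreserving_sliceMap
  rw [← hmp.map_eq, integral_map hmp.measurable.aemeasurable
    (hmp.map_eq.symm ▸ hf.aestronglyMeasurable),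
    integral_prod_symm (fun y : (ℝ × S2) × Set.Ioi (0 : ℝ) => f (sliceMap y.2 y.1))
      ((hmp.integrable_comp hf.aestronglyMeasurable).2 hf),
    Measure.volumeIoiPow]
  simp only [ENNReal.ofReal]
  rw [integral_withDensity_eq_integral_smul (measurable_subtype_coe.pow_const _).real_toNNReal,
    integral_subtype_comap measurableSet_Ioi fun r : ℝ => Real.toNNReal (r ^ 2) •
      ∫ z, f (sliceMap r z) ∂cylinderMeasure]
  simp only [NNReal.smul_def, Real.coe_toNNReal _ (sq_nonneg _), smul_eq_mul]

theorem energy_eq_lintegral_sliceMap {Λ m : ℝ} {ψ : Spacetime → ℝ} (hr : 0 < r)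
    (hF : 0 < warp Λ m r) :
    energy Λ m ψ r =
      ∫⁻ z, ENNReal.ofReal (r ^ 2 * energyDensity Λ m ψ (sliceMap r z)) ∂cylinderMeasure := by
  have : 0 < √(warp Λ m r) := Real.sqrt_pos.2 hF
  change ∫⁻ p, _ ∂(Measure.map (sliceMap r) _) = _
  rw [(measurableEmbedding_sliceMap hr.ne').lintegral_map, lintegral_smul_measure, smul_eq_mul,
    ← lintegral_const_mul' _ _ ENNReal.ofReal_ne_top]
  refine lintegral_congr fun z => ?_
  rw [← ENNReal.ofReal_mul (by positivity), radius_sliceMap hr.le, lapse]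
  congr 1
  field_simp

end Slices

section CompactSupport

variable {Λ m a C R : ℝ} {ψ : Spacetime → ℝ} {ζ : ℝ → ℝ} {p : Spacetime}

theorem isCompact_shell (R : ℝ) {K : Set ℝ} (hK : IsCompact K) :
    IsCompact {q : Spacetime | |q.1| ≤ R ∧ radius q ∈ K} := by
  obtain ⟨b, hb⟩ := hK.bddAbove
  refine ((isCompact_Icc (a := -R) (b := R)).prod
    (isCompact_closedBall (0 : E3) b)).of_isClosed_subset ?_ fun q hq =>
      ⟨abs_le.1 hq.1, mem_closedBall_zero_iff.2 (hb hq.2)⟩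
  exact (isClosed_le continuous_fst.abs continuous_const).inter
    (hK.isClosed.preimage continuous_radius)

theorem tsupport_mul_coneCutoff_smul_subset {E : Type*} [NormedAddCommGroup E] [NormedSpace ℝ E]
    (hC : 0 ≤ C) (ζ : ℝ → ℝ) (R : ℝ) (W : Spacetime → E) :
    tsupport (fun q => (ζ (radius q) * coneCutoff C R q) • W q) ⊆
      {q | |q.1| ≤ R ∧ radius q ∈ tsupport ζ} := by
  refine closure_minimal (fun q hq => ?_) ((isClosed_le continuous_fst.abs continuous_const).inter
    ((isClosed_tsupport ζ).preimage continuous_radius))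
  have hweight := left_ne_zero_of_smul hq
  refine ⟨?_, subset_tsupport ζ (left_ne_zero_of_mul hweight)⟩
  by_contra! hlt
  exact right_ne_zero_of_mul hweight (coneCutoff_eq_zero hC hlt.le)

theorem continuousAt_energyDensity (hψ : ContDiffAt ℝ 2 ψ p) (hp : 0 < radius p)
    (hF : 0 < warp Λ m (radius p)) : ContinuousAt (energyDensity Λ m ψ) p := by
  have hwarp := (contDiffAt_warp_radius (Λ := Λ) (m := m) hp (n := 1)).continuousAt
  have hradial := (contDiffAt_radialDeriv hψ hp).continuousAt
  have hspatial := (contDiffAt_spatialGradient hψ).continuousAt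
  have htime : ContinuousAt (fun q => fderiv ℝ ψ q vecT) p :=
    (hψ.continuousAt_fderiv two_ne_zero).clm_apply continuousAt_const
  refine (((hwarp.mul (hradial.pow 2)).add ((hwarp.inv₀ hF.ne').mul (htime.pow 2))).add
    ((hspatial.norm.pow 2).sub (hradial.pow 2))).congr ?_
  filter_upwards [hψ.eventually (by simp), eventually_warp_radius_pos hp hF] with q hq
    ⟨hradius, hwarp⟩
  exact (energyDensity_eq (hq.differentiableAt two_ne_zero) hradius hwarp).symm

theorem hasCompactSupport_mul_coneCutoff_smul {E : Type*} [NormedAddCommGroup E] [NormedSpace ℝ E]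
    (hC : 0 ≤ C) (hζ : HasCompactSupport ζ) (R : ℝ) (W : Spacetime → E) :
    HasCompactSupport (fun q => (ζ (radius q) * coneCutoff C R q) • W q) :=
  (isCompact_shell R hζ).of_isClosed_subset (isClosed_tsupport _)
    (tsupport_mul_coneCutoff_smul_subset hC ζ R W)

variable (ha : 0 ≤ a) (hF : ∀ r, a < r → 0 < warp Λ m r)
  (hψ : ∀ p, a < radius p → ContDiffAt ℝ 2 ψ p) (hC : 0 ≤ C) (hζ : ContDiff ℝ 1 ζ)
  (hζc : HasCompactSupport ζ) (hζa : tsupport ζ ⊆ Set.Ioi a)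

include ha hF hψ hC hζ hζa

theorem contDiff_smul_energyCurrent :
    ContDiff ℝ 1 (fun q => (ζ (radius q) * coneCutoff C R q) • energyCurrent Λ m ψ q) :=
  contDiff_iff_contDiffAt.2 fun q => by
    by_cases hq : q ∈ tsupport fun q => (ζ (radius q) * coneCutoff C R q) • energyCurrent Λ m ψ q
    swap
    · exact contDiffAt_const.congr_of_eventuallyEq (notMem_tsupport_iff_eventuallyEq.1 hq)
    have haq : a < radius q := hζa (tsupport_mul_coneCutoff_smul_subset hC ζ R _ hq).2
    exact (contDiffAt_comp_radius_mul_coneCutoff hζ (ha.trans_lt haq)).smul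
      (contDiffAt_energyCurrent (hψ q haq) (ha.trans_lt haq) (hF _ haq))

include hζc

theorem integrable_deriv_mul_energyDensity :
    Integrable fun q => deriv ζ (radius q) * coneCutoff C R q * energyDensity Λ m ψ q := by
  refine (continuous_of_tsupport fun q hq => ?_).integrable_of_hasCompactSupport
    (hasCompactSupport_mul_coneCutoff_smul hC hζc.deriv R (energyDensity Λ m ψ))
  have haq : a < radius q := hζa (tsupport_deriv_subset
    (tsupport_mul_coneCutoff_smul_subset hC (deriv ζ) R (energyDensity Λ m ψ) hq).2)
  exact (((hζ.continuous_deriv le_rfl).comp continuous_radius).continuousAt.mul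
    (continuous_coneCutoff C R).continuousAt).mul
      (continuousAt_energyDensity (hψ q haq) (ha.trans_lt haq) (hF _ haq))

theorem integral_deriv_mul_energyDensity_nonneg (ham : 3 * m ≤ a)
    (hwave : ∀ p, a < radius p → waveOperator Λ m ψ p = 0)
    (hFC : ∀ r, a < r → (warp Λ m r)⁻¹ ≤ C) (hζ₀ : 0 ≤ ζ) :
    0 ≤ ∫ q, deriv ζ (radius q) * coneCutoff C R q * energyDensity Λ m ψ q := by
  have : (volume : Measure Spacetime).IsAddHaarMeasure :=
    Measure.prod.instIsAddHaarMeasure volume volume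
  set W := fun q => (ζ (radius q) * coneCutoff C R q) • energyCurrent Λ m ψ q
  have hW : ContDiff ℝ 1 W := contDiff_smul_energyCurrent ha hF hψ hC hζ hζa
  have hWc : HasCompactSupport W := hasCompactSupport_mul_coneCutoff_smul hC hζc R _
  have hflux := integrable_deriv_mul_energyDensity (R := R) ha hF hψ hC hζ hζc hζa
  have hle : ∀ q, -(deriv ζ (radius q) * coneCutoff C R q * energyDensity Λ m ψ q / 2) ≤
      divergence W q := by
    intro q
    by_cases haq : a < radius q
    · exact neg_le_divergence_smul_energyCurrent (hψ q haq) (ha.trans_lt haq) (hF _ haq)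
        (ham.trans haq.le) (hwave q haq) (hFC _ haq) hζ hζ₀
    · have hζ' : deriv ζ (radius q) = 0 :=
        image_eq_zero_of_notMem_tsupport fun h => haq (hζa (tsupport_deriv_subset h))
      have hzero : W =ᶠ[nhds q] fun _ => 0 := notMem_tsupport_iff_eventuallyEq.1 fun h =>
        haq (hζa (tsupport_mul_coneCutoff_smul_subset hC ζ R _ h).2)
      simp [hζ', divergence, hzero.fderiv_eq]
  have hmono := integral_mono (hflux.div_const 2).neg (integrable_divergence volume hW hWc) hle
  rw [integral_divergence_eq_zero volume hW hWc, integral_neg', integral_div] at hmono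
  linarith

end CompactSupport

section LocalEnergy

variable {Λ m a C R r : ℝ} {ψ : Spacetime → ℝ}

/-- The energy on `Σ_r` localized by the cutoff `coneCutoff C R`, as a real number. -/
def localEnergy (Λ m : ℝ) (ψ : Spacetime → ℝ) (C R r : ℝ) : ℝ :=
  r ^ 2 * ∫ z, coneCutoff C R (sliceMap r z) * energyDensity Λ m ψ (sliceMap r z) ∂cylinderMeasure

theorem coneCutoff_sliceMap_mul_eq_zero (hC : 0 ≤ C) (r : ℝ) {z : ℝ × S2}
    (hz : z ∉ Set.Icc (-R) R ×ˢ (Set.univ : Set S2)) (u : ℝ) :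
    coneCutoff C R (sliceMap r z) * u = 0 := by
  refine mul_eq_zero_of_left (coneCutoff_eq_zero hC ?_) u
  by_contra! h
  exact hz ⟨abs_le.1 h.le, trivial⟩

variable (ha : 0 ≤ a) (hF : ∀ r, a < r → 0 < warp Λ m r)
  (hψ : ∀ p, a < radius p → ContDiffAt ℝ 2 ψ p)

include ha hF hψ

theorem continuousOn_coneCutoff_mul_energyDensity (C R : ℝ) :
    ContinuousOn (fun y : ℝ × (ℝ × S2) => coneCutoff C R (sliceMap y.1 y.2)
      * energyDensity Λ m ψ (sliceMap y.1 y.2)) (Set.Ioi a ×ˢ Set.univ) := by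
  refine ((continuous_coneCutoff C R).comp continuous_uncurry_sliceMap).continuousOn.mul
    fun ⟨r, z⟩ ⟨hr, _⟩ => ContinuousAt.continuousWithinAt ?_
  have har : a < radius (sliceMap r z) := by rwa [radius_sliceMap (ha.trans hr.le)]
  exact ContinuousAt.comp (g := energyDensity Λ m ψ) (f := Function.uncurry sliceMap)
    (continuousAt_energyDensity (hψ _ har) (ha.trans_lt har) (hF _ har))
    continuous_uncurry_sliceMap.continuousAt

theorem continuous_coneCutoff_mul_energyDensity_sliceMap (C R : ℝ) (hr : a < r) :
    Continuous fun z => coneCutoff C R (sliceMap r z) * energyDensity Λ m ψ (sliceMap r z) :=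
  (continuousOn_coneCutoff_mul_energyDensity ha hF hψ C R).comp_continuous
    (f := fun z : ℝ × S2 => (r, z)) (by fun_prop) fun _ => ⟨hr, trivial⟩

variable (hC : 0 ≤ C)

include hC

theorem continuousOn_localEnergy (R : ℝ) : ContinuousOn (localEnergy Λ m ψ C R) (Set.Ioi a) :=
  (continuous_pow 2).continuousOn.mul <| continuousOn_integral_of_compact_support
    (k := Set.Icc (-R) R ×ˢ Set.univ) (isCompact_Icc.prod isCompact_univ)
    (continuousOn_coneCutoff_mul_energyDensity ha hF hψ C R)
    fun r _ _ hz => coneCutoff_sliceMap_mul_eq_zero hC r hz _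

theorem ofReal_localEnergy (R : ℝ) (hr : a < r) :
    ENNReal.ofReal (localEnergy Λ m ψ C R r) =
      ∫⁻ z, ENNReal.ofReal (r ^ 2 * (coneCutoff C R (sliceMap r z)
        * energyDensity Λ m ψ (sliceMap r z))) ∂cylinderMeasure := by
  have hint := (continuous_coneCutoff_mul_energyDensity_sliceMap ha hF hψ C R hr)
    |>.integrable_of_hasCompactSupport (μ := cylinderMeasure)
    (HasCompactSupport.intro (isCompact_Icc.prod isCompact_univ)
      fun z hz => coneCutoff_sliceMap_mul_eq_zero hC r hz _)
  rw [localEnergy, ← integral_const_mul]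
  exact ofReal_integral_eq_lintegral_ofReal (hint.const_mul _) (.of_forall fun z =>
    mul_nonneg (sq_nonneg r) (mul_nonneg (coneCutoff_nonneg C R _) (energyDensity_nonneg Λ m ψ _)))

theorem tendsto_ofReal_localEnergy (hr : a < r) :
    Filter.Tendsto (fun n : ℕ => ENNReal.ofReal (localEnergy Λ m ψ C n r)) Filter.atTop
      (nhds (energy Λ m ψ r)) := by
  simp only [ofReal_localEnergy ha hF hψ hC _ hr,
    energy_eq_lintegral_sliceMap (ha.trans_lt hr) (hF r hr)]
  refine lintegral_tendsto_of_tendsto_of_monotone (fun n => Continuous.aemeasurable ?_)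
    (.of_forall fun z n k hnk => ENNReal.ofReal_le_ofReal ?_) (.of_forall fun z => ?_)
  · exact ENNReal.continuous_ofReal.comp (continuous_const.mul
      (continuous_coneCutoff_mul_energyDensity_sliceMap ha hF hψ C n hr))
  · have := energyDensity_nonneg Λ m ψ (sliceMap r z)
    have := monotone_coneCutoff C (sliceMap r z) (Nat.cast_le.2 hnk : (n : ℝ) ≤ k)
    gcongr
  · refine tendsto_const_nhds.congr' ?_
    filter_upwards [tendsto_natCast_atTop_atTop.eventually_ge_atTop
      (√(1 + (sliceMap r z).1 ^ 2) + C * radius (sliceMap r z) + 1)] with n hn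
    rw [coneCutoff_eq_one hn, one_mul]

theorem antitoneOn_localEnergy (ham : 3 * m ≤ a)
    (hwave : ∀ p, a < radius p → waveOperator Λ m ψ p = 0)
    (hFC : ∀ r, a < r → (warp Λ m r)⁻¹ ≤ C) (R : ℝ) :
    AntitoneOn (localEnergy Λ m ψ C R) (Set.Ioi a) := by
  refine antitoneOn_of_integral_deriv_mul_nonneg (continuousOn_localEnergy ha hF hψ hC R)
    fun ζ hζ hζ₀ hζc hζa => ?_
  have hzero : ∀ r ∉ Set.Ioi (0 : ℝ), deriv ζ r * localEnergy Λ m ψ C R r = 0 := fun r hr =>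
    mul_eq_zero_of_left (image_eq_zero_of_notMem_tsupport fun h =>
      hr (ha.trans_lt (hζa (tsupport_deriv_subset h)))) _
  calc 0 ≤ ∫ q, deriv ζ (radius q) * coneCutoff C R q * energyDensity Λ m ψ q :=
        integral_deriv_mul_energyDensity_nonneg ha hF hψ hC hζ hζc hζa ham hwave hFC hζ₀
    _ = ∫ r in Set.Ioi 0, deriv ζ r * localEnergy Λ m ψ C R r := by
        rw [integral_eq_integral_sliceMap
          (integrable_deriv_mul_energyDensity ha hF hψ hC hζ hζc hζa)]
        refine setIntegral_congr_fun measurableSet_Ioi fun r hr => ?_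
        simp only [radius_sliceMap (le_of_lt hr), mul_assoc, integral_const_mul, localEnergy]
        ring
    _ = ∫ r, deriv ζ r * localEnergy Λ m ψ C R r :=
        setIntegral_eq_integral_of_forall_compl_eq_zero hzero

end LocalEnergy

end

end SdS

open SdS

theorem mainTheorem2_general {Λ m a : ℝ} (ha : 0 < a) (ham : 3 * m ≤ a) (hFa : 0 ≤ warp Λ m a)
    {ψ : Spacetime → ℝ} (hψ : ContDiffOn ℝ 2 ψ {p | a < radius p})
    (hwave : ∀ p, a < radius p → waveOperator Λ m ψ p = 0) :
    AntitoneOn (energy Λ m ψ) (Set.Ioi a) := by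
  intro r₁ h₁ r₂ _ h₁₂
  obtain ⟨b, hab, hb⟩ := exists_between (Set.mem_Ioi.1 h₁)
  have hF : ∀ r, b < r → 0 < warp Λ m r := fun r hr => warp_pos ha ham hFa (hab.trans hr)
  have hFb : 0 < warp Λ m b := warp_pos ha ham hFa hab
  have hFC : ∀ r, b < r → (warp Λ m r)⁻¹ ≤ (warp Λ m b)⁻¹ := fun r hr =>
    inv_anti₀ hFb (monotoneOn_warp ha ham hFa hab (hab.trans hr) hr.le)
  have hC : 0 ≤ (warp Λ m b)⁻¹ := inv_nonneg.2 hFb.le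
  have hψ' : ∀ p, b < radius p → ContDiffAt ℝ 2 ψ p := fun p hp =>
    hψ.contDiffAt ((isOpen_lt continuous_const continuous_radius).mem_nhds (hab.trans hp))
  have hlim := fun {r : ℝ} (hr : b < r) =>
    tendsto_ofReal_localEnergy (ha.trans hab).le hF hψ' hC hr
  refine le_of_tendsto_of_tendsto' (hlim (hb.trans_le h₁₂)) (hlim hb) fun n =>
    ENNReal.ofReal_le_ofReal ?_
  exact antitoneOn_localEnergy (ha.trans hab).le hF hψ' hC (ham.trans hab.le)
    (fun p hp => hwave p (hab.trans hp)) hFC n hb (hb.trans_le h₁₂) h₁₂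

theorem mainTheorem2 (Λ m : ℝ) (hΛ : 0 < Λ) (hm : 0 < m) (hsub : 3 * m * √Λ < 1)
    (ψ : SdS.Spacetime → ℝ) (hψ : SdS.IsWaveSolution Λ m ψ)
    (r₁ r₂ : ℝ) (h₁ : SdS.cosmologicalRadius Λ m < r₁) (h₂ : r₁ < r₂) :
    SdS.energy Λ m ψ r₂ ≤ SdS.energy Λ m ψ r₁ :=
  have hroot := (isGreatest_cosmologicalRadius hΛ hm hsub).1
  mainTheorem2_general hroot.1 (three_mul_le_cosmologicalRadius hΛ hm hsub) hroot.2.ge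
    hψ.contDiffOn hψ.wave_eq h₁ (h₁.trans h₂) h₂.le
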